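/- Let $S$ be a finite set of pairwise distinct points in the Euclidean plane $\mathbb{R}^2$ with an even number of elements, and let $M$ be a max-sum matching of $S$, that is, a perfect matching of $S$ such that the sum $\sum_{ab\in M}\|a-b\|$ of the Euclidean lengths of its edges is maximal among all perfect matchings of $S$. Then $M$ is an open Tverberg graph, that is, the open discs having the edges of $M$ as diameters share a common point: $$\bigcap_{ab\in M}\Big\{x\in\mathbb{R}^2 : \Big\|x-\frac{a+b}{2}\Big\|<\frac{\|a-b\|}{2}\Big\}\neq\emptyset .$$ (For $S=\emptyset$ the intersection over the empty family is understood to be the whole plane.) -/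

import Mathlib

/-- The length of an edge: the Euclidean distance between its two endpoints. -/
noncomputable def edgeLength {d : ℕ} {S : Finset (EuclideanSpace ℝ (Fin d))} :
    Sym2 ↥S → ℝ :=
  Sym2.lift ⟨fun x y => dist (x : EuclideanSpace ℝ (Fin d)) (y : EuclideanSpace ℝ (Fin d)),
    fun _ _ => dist_comm _ _⟩

open Classical in
/-- The cost of a graph with vertex set `S`: the sum of the Euclidean lengths of its edges
(each unordered edge is counted once). -/
noncomputable def graphCost {d : ℕ} {S : Finset (EuclideanSpace ℝ (Fin d))}
    (G : SimpleGraph ↥S) : ℝ :=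
  ∑ e ∈ G.edgeFinset, edgeLength e

/-- A graph is a perfect matching (of its whole vertex set) if each vertex has exactly one
neighbour. -/
def IsPerfectMatchingGraph {V : Type*} (G : SimpleGraph V) : Prop :=
  (⊤ : G.Subgraph).IsPerfectMatching

/-- A max-sum matching of `S`: a perfect matching of `S` whose cost is maximal among all perfect
matchings of `S`. -/
def IsMaxSumMatching {d : ℕ} {S : Finset (EuclideanSpace ℝ (Fin d))}
    (M : SimpleGraph ↥S) : Prop :=
  IsPerfectMatchingGraph M ∧
    ∀ M' : SimpleGraph ↥S, IsPerfectMatchingGraph M' → graphCost M' ≤ graphCost M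

/-- The open ball that has the segment from `x` to `y` as a diameter. -/
noncomputable def openDiametralBall {d : ℕ} (x y : EuclideanSpace ℝ (Fin d)) :
    Set (EuclideanSpace ℝ (Fin d)) :=
  Metric.ball (midpoint ℝ x y) (dist x y / 2)

/-- An open Tverberg graph: the open balls with the edges as diameters have a common point. -/
def IsOpenTverbergGraph {d : ℕ} {S : Finset (EuclideanSpace ℝ (Fin d))}
    (G : SimpleGraph ↥S) : Prop :=
  (⋂ (x : ↥S) (y : ↥S) (_ : G.Adj x y),
    openDiametralBall (x : EuclideanSpace ℝ (Fin d)) (y : EuclideanSpace ℝ (Fin d))).Nonempty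

/-! Minimise the maximum over all edges `ab` of the power of `o` with respect to the disc on `ab`,
which equals `⟪a - o, b - o⟫`. If the minimum is negative, the minimiser lies in every disc.
Otherwise the minimiser, taken as origin, sees each active edge under a non-obtuse angle and is a
positive combination of at most three active midpoints (`exists_common_point_or_combination`). It
remains to find an exchange among these edges that increases the total length.

Give the endpoints of an edge the weights `-⟪a, u⟫` and `⟪b, u⟫`, where `u` is the direction of `b -
a`; they add up to its length. Since the angle is non-obtuse, `‖b - a‖ ≤ ‖a + b‖`, and each weight
is bounded by the projection of its endpoint on every direction in an explicit arc (`left_le`,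
`right_le`). If such arcs for two points contain opposite directions, the distance of the points is
at least the sum of their weights. So an exchange whose new edges all have this property loses
nothing, and it gains as soon as one bound is strict.

The sums `a + b` of the chosen edges have two opposite directions or positively span the plane
(`exists_directions`). Opposite directions allow a swap of two edges. In the spanning case, the
cyclic order of the directions of `b - a` decides between a three-cycle and a swap
(`exists_exchange`). -/

open scoped RealInnerProductSpace

/-! ### Unit vectors and cosine inequalities -/

/-- The unit vector of the plane in direction `t`. -/
noncomputable def unitVec (t : ℝ) : EuclideanSpace ℝ (Fin 2) := !₂[Real.cos t, Real.sin t]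

lemma inner_unitVec (x : EuclideanSpace ℝ (Fin 2)) (t : ℝ) :
    ⟪x, unitVec t⟫ = x 0 * Real.cos t + x 1 * Real.sin t := by
  simp [unitVec, PiLp.inner_apply, Fin.sum_univ_two, mul_comm]

lemma inner_unitVec_unitVec (s t : ℝ) : ⟪unitVec s, unitVec t⟫ = Real.cos (s - t) := by
  rw [inner_unitVec, Real.cos_sub]; simp [unitVec]

lemma norm_unitVec (t : ℝ) : ‖unitVec t‖ = 1 := by
  rw [← sq_eq_sq₀ (norm_nonneg _) zero_le_one, ← real_inner_self_eq_norm_sq,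
    inner_unitVec_unitVec]
  simp

lemma unitVec_add_pi (t : ℝ) : unitVec (t + Real.pi) = -unitVec t := by
  ext i; fin_cases i <;> simp [unitVec]

lemma unitVec_add_two_pi (t : ℝ) : unitVec (t + 2 * Real.pi) = unitVec t := by
  ext i; fin_cases i <;> simp [unitVec]

/-- Polar coordinates measured from an arbitrary direction. -/
lemma exists_polar (g : ℝ) (v : EuclideanSpace ℝ (Fin 2)) :
    ∃ k, -Real.pi < k ∧ k ≤ Real.pi ∧ v = ‖v‖ • unitVec (g + k) := by
  -- `v` rotated by `-g`, so that its argument is the angle measured from `g`.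
  set z : ℂ := ⟨v 0 * Real.cos g + v 1 * Real.sin g, v 1 * Real.cos g - v 0 * Real.sin g⟩ with hz
  have hn : ‖z‖ = ‖v‖ := by
    rw [← sq_eq_sq₀ (norm_nonneg _) (norm_nonneg _), ← Complex.normSq_eq_norm_sq,
      EuclideanSpace.norm_sq_eq, Complex.normSq_apply, Fin.sum_univ_two]
    simp only [hz, Real.norm_eq_abs, sq_abs]
    linear_combination (v 0 ^ 2 + v 1 ^ 2) * Real.sin_sq_add_cos_sq g
  have h1 : ‖v‖ * Real.cos z.arg = z.re := by rw [← hn, Complex.norm_mul_cos_arg]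
  have h2 : ‖v‖ * Real.sin z.arg = z.im := by rw [← hn, Complex.norm_mul_sin_arg]
  refine ⟨z.arg, Complex.neg_pi_lt_arg z, Complex.arg_le_pi z, ?_⟩
  simp only [hz] at h1 h2
  ext i
  fin_cases i
  · simp only [unitVec, Real.cos_add, Real.sin_add, Fin.zero_eta, PiLp.smul_apply, smul_eq_mul,
      Matrix.cons_val_zero]
    linear_combination -Real.cos g * h1 + Real.sin g * h2 - v 0 * Real.sin_sq_add_cos_sq g
  · simp only [unitVec, Real.cos_add, Real.sin_add, Fin.mk_one, PiLp.smul_apply, smul_eq_mul,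
      Matrix.cons_val_one, Matrix.cons_val_zero]
    linear_combination -Real.sin g * h1 - Real.cos g * h2 - v 1 * Real.sin_sq_add_cos_sq g

lemma inner_sub_inner_le_dist (x y : EuclideanSpace ℝ (Fin 2)) (t : ℝ) :
    ⟪x, unitVec t⟫ - ⟪y, unitVec t⟫ ≤ dist x y := by
  rw [← inner_sub_left, dist_eq_norm]
  simpa [norm_unitVec] using real_inner_le_norm (x - y) (unitVec t)

lemma one_add_cos_add_le {p q : ℝ} (hp : 0 ≤ p) (hq : 0 ≤ q) (h : p + q ≤ Real.pi) :
    1 + Real.cos (p + q) ≤ Real.cos p + Real.cos q := by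
  have h1 : Real.cos ((p + q) / 2) ≤ Real.cos ((p - q) / 2) := by
    rw [← Real.cos_abs ((p - q) / 2)]
    refine Real.cos_le_cos_of_nonneg_of_le_pi (abs_nonneg _) (by linarith) ?_
    rw [abs_le]; constructor <;> linarith
  have h2 : 0 ≤ Real.cos ((p + q) / 2) :=
    Real.cos_nonneg_of_mem_Icc ⟨by linarith [Real.pi_pos], by linarith⟩
  have h3 : Real.cos (p + q) = 2 * Real.cos ((p + q) / 2) ^ 2 - 1 := by
    rw [← Real.cos_two_mul]; congr 1; ring
  rw [Real.cos_add_cos, h3]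
  nlinarith

lemma one_add_cos_add_lt {p q : ℝ} (hp : 0 < p) (hq : 0 < q) (h : p + q < Real.pi) :
    1 + Real.cos (p + q) < Real.cos p + Real.cos q := by
  have h1 : Real.cos ((p + q) / 2) < Real.cos ((p - q) / 2) := by
    rw [← Real.cos_abs ((p - q) / 2)]
    refine Real.cos_lt_cos_of_nonneg_of_le_pi (abs_nonneg _) (by linarith) ?_
    rw [abs_lt]; constructor <;> linarith
  have h2 : 0 < Real.cos ((p + q) / 2) :=
    Real.cos_pos_of_mem_Ioo ⟨by linarith [Real.pi_pos], by linarith⟩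
  have h3 : Real.cos (p + q) = 2 * Real.cos ((p + q) / 2) ^ 2 - 1 := by
    rw [← Real.cos_two_mul]; congr 1; ring
  rw [Real.cos_add_cos, h3]
  nlinarith

/-! ### Edges in polar coordinates and bounds on the weights of their endpoints -/

/-- The segment `ab`, seen from the origin under a non-obtuse angle, in polar coordinates: `g` is
the direction of `a + b`, and `d` the direction of `b - a`. -/
structure PolarEdge (a b : EuclideanSpace ℝ (Fin 2)) (g d : ℝ) : Prop where
  add_eq : a + b = ‖a + b‖ • unitVec g
  sub_eq : b - a = ‖b - a‖ • unitVec d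
  sub_pos : 0 < ‖b - a‖
  sub_le_add : ‖b - a‖ ≤ ‖a + b‖
  le : g ≤ d
  lt : d < g + Real.pi

namespace PolarEdge

variable {a b a' b' : EuclideanSpace ℝ (Fin 2)} {g d g' d' t : ℝ}

lemma shift (h : PolarEdge a b g d) : PolarEdge a b (g + 2 * Real.pi) (d + 2 * Real.pi) where
  add_eq := by rw [unitVec_add_two_pi]; exact h.add_eq
  sub_eq := by rw [unitVec_add_two_pi]; exact h.sub_eq
  sub_pos := h.sub_pos
  sub_le_add := h.sub_le_add
  le := by linarith [h.le]
  lt := by linarith [h.lt]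

lemma inner_left (h : PolarEdge a b g d) (t : ℝ) :
    2 * ⟪a, unitVec t⟫ = ‖a + b‖ * Real.cos (g - t) - ‖b - a‖ * Real.cos (d - t) := by
  have h1 : (2 : ℝ) • a = ‖a + b‖ • unitVec g - ‖b - a‖ • unitVec d := by
    rw [← h.add_eq, ← h.sub_eq, two_smul]; abel
  rw [← inner_unitVec_unitVec, ← inner_unitVec_unitVec, ← real_inner_smul_left,
    ← real_inner_smul_left, ← real_inner_smul_left, ← inner_sub_left, h1]

lemma inner_right (h : PolarEdge a b g d) (t : ℝ) :
    2 * ⟪b, unitVec t⟫ = ‖a + b‖ * Real.cos (g - t) + ‖b - a‖ * Real.cos (d - t) := by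
  have h1 : (2 : ℝ) • b = ‖a + b‖ • unitVec g + ‖b - a‖ • unitVec d := by
    rw [← h.add_eq, ← h.sub_eq, two_smul]; abel
  rw [← inner_unitVec_unitVec, ← inner_unitVec_unitVec, ← real_inner_smul_left,
    ← real_inner_smul_left, ← real_inner_smul_left, ← inner_add_left, h1]

lemma dist_eq (h : PolarEdge a b g d) : dist a b = ⟪b, unitVec d⟫ - ⟪a, unitVec d⟫ := by
  have h1 := h.inner_left d
  have h2 := h.inner_right d
  rw [dist_comm, dist_eq_norm]
  simp only [sub_self, Real.cos_zero] at h1 h2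
  linarith

/-- Twice the difference of the two sides is `‖a + b‖ * (cos p + cos q) - ‖b - a‖ * (1 + cos (p +
q))` with `p = g - t` and `q = d - g`, so `one_add_cos_add_le` and `‖b - a‖ ≤ ‖a + b‖` suffice. -/
lemma left_le (h : PolarEdge a b g d) (h1 : d - Real.pi ≤ t) (h2 : t ≤ g) :
    -⟪a, unitVec d⟫ ≤ ⟪a, unitVec t⟫ := by
  have e1 := h.inner_left d
  have e2 := h.inner_left t
  have := one_add_cos_add_le (p := g - t) (q := d - g) (by linarith) (by linarith [h.le])
    (by linarith)
  rw [sub_self, Real.cos_zero, ← neg_sub d g, Real.cos_neg] at e1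
  rw [show g - t + (d - g) = d - t by ring] at this
  nlinarith [h.sub_le_add, h.sub_pos, Real.neg_one_le_cos (d - t)]

lemma left_lt (h : PolarEdge a b g d) (ha : a ≠ 0) (h1 : d - Real.pi < t) (h2 : t < g) :
    -⟪a, unitVec d⟫ < ⟪a, unitVec t⟫ := by
  have e1 := h.inner_left d
  have e2 := h.inner_left t
  rw [sub_self, Real.cos_zero, ← neg_sub d g, Real.cos_neg] at e1
  rcases h.le.lt_or_eq with hlt | heq
  · have := one_add_cos_add_lt (p := g - t) (q := d - g) (by linarith) (by linarith)
      (by linarith)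
    rw [show g - t + (d - g) = d - t by ring] at this
    nlinarith [h.sub_le_add, h.sub_pos, Real.neg_one_le_cos (d - t)]
  -- Here `a + b` and `b - a` are parallel and the cosine inequality is an equality; strictness
  -- comes from `‖b - a‖ < ‖a + b‖`, which follows from `a ≠ 0`.
  · subst heq
    have hne : ‖b - a‖ ≠ ‖a + b‖ := by
      intro hc
      apply ha
      have h3 : a + b = b - a := by rw [h.add_eq, h.sub_eq, hc]
      have h4 : (2 : ℝ) • a = 0 := by
        rw [two_smul]
        have := sub_eq_zero.2 h3
        rw [← this]; abel
      simpa using h4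
    have hl := lt_of_le_of_ne h.sub_le_add hne
    have hc : -1 < Real.cos (g - t) := by
      rw [← Real.cos_pi]
      exact Real.cos_lt_cos_of_nonneg_of_le_pi (by linarith) le_rfl (by linarith)
    rw [sub_self, Real.cos_zero] at e1
    nlinarith

lemma right_le (h : PolarEdge a b g d) (h1 : g ≤ t) (h2 : t ≤ d) :
    ⟪b, unitVec d⟫ ≤ ⟪b, unitVec t⟫ := by
  have e1 := h.inner_right d
  have e2 := h.inner_right t
  have := one_add_cos_add_le (p := t - g) (q := d - t) (by linarith) (by linarith)
    (by linarith [h.lt])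
  rw [sub_self, Real.cos_zero, ← neg_sub d g, Real.cos_neg] at e1
  rw [← neg_sub t g, Real.cos_neg] at e2
  rw [show t - g + (d - t) = d - g by ring] at this
  nlinarith [h.sub_le_add, h.sub_pos, Real.cos_le_one (d - t)]

lemma inner_add_inner_le_dist (x y : EuclideanSpace ℝ (Fin 2)) (t : ℝ) :
    ⟪x, unitVec t⟫ + ⟪y, unitVec (t + Real.pi)⟫ ≤ dist x y := by
  rw [unitVec_add_pi, inner_neg_right]
  exact inner_sub_inner_le_dist x y t

/-- The arc `[d - π, g]` of `a` meets the arc `[g', d']` of `b'` turned by `-π`; any common `t`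
bounds both weights. -/
lemma left_right_le (h : PolarEdge a b g d) (h' : PolarEdge a' b' g' d') (hg : g' ≤ g + Real.pi)
    (hd : d ≤ d') : -⟪a, unitVec d⟫ + ⟪b', unitVec d'⟫ ≤ dist a b' := by
  obtain ⟨t, ht1, ht2⟩ : ∃ t, max (d - Real.pi) (g' - Real.pi) ≤ t ∧ t ≤ min g (d' - Real.pi) :=
    ⟨_, le_rfl, by
      have := h.lt; have := h'.le
      simp only [max_le_iff, le_min_iff]; refine ⟨⟨?_, ?_⟩, ?_, ?_⟩ <;> linarith⟩
  simp only [max_le_iff, le_min_iff] at ht1 ht2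
  have := h.left_le ht1.1 ht2.1
  have := h'.right_le (t := t + Real.pi) (by linarith) (by linarith)
  linarith [inner_add_inner_le_dist a b' t]

lemma left_right_lt (h : PolarEdge a b g d) (h' : PolarEdge a' b' g' d') (hg : g' < g + Real.pi)
    (hd : d < d') (ha : a ≠ 0) : -⟪a, unitVec d⟫ + ⟪b', unitVec d'⟫ < dist a b' := by
  obtain ⟨t, ht1, ht2, ht3, ht4⟩ : ∃ t, d - Real.pi < t ∧ g' - Real.pi ≤ t ∧ t < g ∧
      t ≤ d' - Real.pi := by
    have := h.lt; have := h'.le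
    rcases le_or_gt g' d with hc | hc
    · refine ⟨(d - Real.pi + min g (d' - Real.pi)) / 2, ?_⟩
      have h1 : d - Real.pi < min g (d' - Real.pi) := by
        rw [lt_min_iff]; constructor <;> linarith
      have h2 := min_le_left g (d' - Real.pi)
      have h3 := min_le_right g (d' - Real.pi)
      refine ⟨?_, ?_, ?_, ?_⟩ <;> linarith
    · exact ⟨g' - Real.pi, by linarith, le_rfl, by linarith, by linarith⟩
  have := h.left_lt ha ht1 ht3
  have := h'.right_le (t := t + Real.pi) (by linarith) (by linarith)
  linarith [inner_add_inner_le_dist a b' t]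

lemma left_left_lt (h : PolarEdge a b g d) (h' : PolarEdge a' b' g' d') (h1 : d < g')
    (h2 : d' < g + 2 * Real.pi) (ha : a ≠ a') :
    -⟪a, unitVec d⟫ + -⟪a', unitVec d'⟫ < dist a a' := by
  obtain ⟨t, ht1, ht2⟩ : ∃ t, max (d - Real.pi) (d' - 2 * Real.pi) < t ∧
      t < min g (g' - Real.pi) := by
    apply exists_between
    have := h.lt; have := h'.lt
    simp only [max_lt_iff, lt_min_iff]; refine ⟨⟨?_, ?_⟩, ?_, ?_⟩ <;> linarith
  simp only [max_lt_iff, lt_min_iff] at ht1 ht2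
  have e1 := h.left_le ht1.1.le ht2.1.le
  have e2 := h'.left_le (t := t + Real.pi) (by linarith) (by linarith)
  have e3 := inner_add_inner_le_dist a a' t
  -- At most one of the distinct points `a`, `a'` is the origin; the other one gives a strict bound.
  by_cases h0 : a = 0
  · have := h'.left_lt (t := t + Real.pi) (fun hc => ha (h0.trans hc.symm)) (by linarith)
      (by linarith)
    linarith
  · linarith [h.left_lt h0 ht1.1 ht2.1]

lemma right_right_le (h : PolarEdge a b g d) (h' : PolarEdge a' b' g' d') (h1 : g' ≤ d + Real.pi)
    (h2 : g + Real.pi ≤ d') : ⟪b, unitVec d⟫ + ⟪b', unitVec d'⟫ ≤ dist b b' := by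
  obtain ⟨t, ht1, ht2⟩ : ∃ t, max g (g' - Real.pi) ≤ t ∧ t ≤ min d (d' - Real.pi) :=
    ⟨_, le_rfl, by
      have := h.le; have := h'.le
      simp only [max_le_iff, le_min_iff]; refine ⟨⟨?_, ?_⟩, ?_, ?_⟩ <;> linarith⟩
  simp only [max_le_iff, le_min_iff] at ht1 ht2
  have := h.right_le ht1.1 ht2.1
  have := h'.right_le (t := t + Real.pi) (by linarith) (by linarith)
  linarith [inner_add_inner_le_dist b b' t]

lemma swap_lt (h : PolarEdge a b g d) (h' : PolarEdge a' b' g' d') (h1 : d < g')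
    (h2 : d' < g + 2 * Real.pi) (h3 : g' ≤ d + Real.pi) (h4 : g + Real.pi ≤ d') (ha : a ≠ a') :
    dist a b + dist a' b' < dist a a' + dist b b' := by
  rw [h.dist_eq, h'.dist_eq]
  linarith [h.left_left_lt h' h1 h2 ha, h.right_right_le h' h3 h4]

end PolarEdge

/-- Exchanging the endpoints turns the direction of the difference by `π`, so one of the two orders
puts it in `[g, g + π)`. -/
lemma exists_polarEdge {x y : EuclideanSpace ℝ (Fin 2)} {g : ℝ} (hxy : x ≠ y)
    (h : 0 ≤ ⟪x, y⟫) (hg : x + y = ‖x + y‖ • unitVec g) :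
    (∃ d, PolarEdge x y g d) ∨ ∃ d, PolarEdge y x g d := by
  have hpos : 0 < ‖y - x‖ := norm_pos_iff.2 (sub_ne_zero.2 hxy.symm)
  have hle : ‖y - x‖ ≤ ‖x + y‖ := by
    rw [← sq_le_sq₀ (norm_nonneg _) (norm_nonneg _), norm_sub_sq_real, norm_add_sq_real,
      real_inner_comm]
    linarith
  obtain ⟨k, hk1, hk2, hk⟩ := exists_polar g (y - x)
  by_cases hc : 0 ≤ k ∧ k < Real.pi
  · exact Or.inl ⟨g + k, hg, hk, hpos, hle, by linarith, by linarith⟩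
  · right
    rw [add_comm x y] at hg hle
    rw [norm_sub_rev] at hpos hle
    have hk' : x - y = ‖x - y‖ • -unitVec (g + k) := by
      rw [smul_neg, norm_sub_rev, ← hk, neg_sub]
    by_cases hk0 : 0 ≤ k
    · have hkp : k = Real.pi := le_antisymm hk2 (not_lt.1 fun h => hc ⟨hk0, h⟩)
      rw [hkp, unitVec_add_pi, neg_neg] at hk'
      exact ⟨g, hg, hk', hpos, hle, le_rfl, by linarith [Real.pi_pos]⟩
    · rw [← unitVec_add_pi] at hk'
      exact ⟨_, hg, hk', hpos, hle, by linarith, by linarith⟩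

/-! ### Profitable exchanges -/

namespace PolarEdge

variable {a₁ b₁ a₂ b₂ a₃ b₃ : EuclideanSpace ℝ (Fin 2)} {g₁ d₁ g₂ d₂ g₃ d₃ : ℝ}

/-- The case where the directions of `bᵢ - aᵢ` are out of cyclic order. All conditions of `swap_lt`
except one hold automatically; whether `g₁ + π ≤ d₂` decides which pair of edges to swap. -/
lemma swap_lt_or_swap_lt (h₁ : PolarEdge a₁ b₁ g₁ d₁) (h₂ : PolarEdge a₂ b₂ g₂ d₂)
    (h₃ : PolarEdge a₃ b₃ g₃ d₃) (h12 : g₂ < g₁ + Real.pi) (h23 : g₃ < g₂ + Real.pi)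
    (hd : d₁ + 2 * Real.pi < d₃) (ha12 : a₁ ≠ a₂) (ha23 : a₂ ≠ a₃) :
    dist a₁ b₁ + dist a₂ b₂ < dist a₁ a₂ + dist b₁ b₂ ∨
      dist a₂ b₂ + dist a₃ b₃ < dist a₂ a₃ + dist b₂ b₃ := by
  have := h₁.le; have := h₁.lt; have := h₂.le; have := h₂.lt; have := h₃.le; have := h₃.lt
  rcases le_or_gt (g₁ + Real.pi) d₂ with hc | hc
  · left
    apply h₁.swap_lt h₂ <;> first | assumption | linarith
  · right
    apply h₂.swap_lt h₃ <;> first | assumption | linarith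

/-- If the directions of `aᵢ + bᵢ` positively span the plane, then some exchange of edges is
profitable. -/
theorem exists_exchange (h₁ : PolarEdge a₁ b₁ g₁ d₁) (h₂ : PolarEdge a₂ b₂ g₂ d₂)
    (h₃ : PolarEdge a₃ b₃ g₃ d₃) (h12 : g₂ < g₁ + Real.pi) (h23 : g₃ < g₂ + Real.pi)
    (h31 : g₁ + 2 * Real.pi < g₃ + Real.pi)
    (ha12 : a₁ ≠ a₂) (ha23 : a₂ ≠ a₃) (ha31 : a₃ ≠ a₁) :
    dist a₁ b₁ + dist a₂ b₂ < dist a₁ a₂ + dist b₁ b₂ ∨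
    dist a₂ b₂ + dist a₃ b₃ < dist a₂ a₃ + dist b₂ b₃ ∨
    dist a₃ b₃ + dist a₁ b₁ < dist a₃ a₁ + dist b₃ b₁ ∨
    dist a₁ b₁ + dist a₂ b₂ + dist a₃ b₃ < dist a₁ b₂ + dist a₂ b₃ + dist a₃ b₁ := by
  rcases lt_or_ge (d₁ + 2 * Real.pi) d₃ with hc | c31
  · rcases h₁.swap_lt_or_swap_lt h₂ h₃ h12 h23 hc ha12 ha23 with h | h
    exacts [Or.inl h, Or.inr (Or.inl h)]
  rcases lt_or_ge d₂ d₁ with hc | c12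
  · rcases h₂.swap_lt_or_swap_lt h₃ h₁.shift h23 h31 (by linarith)
      ha23 ha31 with h | h
    exacts [Or.inr (Or.inl h), Or.inr (Or.inr (Or.inl h))]
  rcases lt_or_ge d₃ d₂ with hc | c23
  · rcases h₃.swap_lt_or_swap_lt h₁.shift h₂.shift h31 (by linarith)
      (by linarith) ha31 ha12 with h | h
    exacts [Or.inr (Or.inr (Or.inl h)), Or.inl h]
  -- Now `d₁ ≤ d₂ ≤ d₃ ≤ d₁ + 2π`, and the three-cycle loses nothing. Its gain is strict if some
  -- positive gap starts at an edge with `aᵢ ≠ 0`. At most one gap vanishes and at most one `aᵢ` is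
  -- the origin, so this happens for one of the three.
  refine Or.inr (Or.inr (Or.inr ?_))
  rw [h₁.dist_eq, h₂.dist_eq, h₃.dist_eq]
  have e12 := h₁.left_right_le h₂ h12.le c12
  have e23 := h₂.left_right_le h₃ h23.le c23
  have e31 := h₃.left_right_le h₁.shift h31.le c31
  rw [unitVec_add_two_pi] at e31
  have s12 : a₁ ≠ 0 → d₁ < d₂ → _ := fun ha hd => h₁.left_right_lt h₂ h12 hd ha
  have s23 : a₂ ≠ 0 → d₂ < d₃ → _ := fun ha hd => h₂.left_right_lt h₃ h23 hd ha
  have s31 : a₃ ≠ 0 → d₃ < d₁ + 2 * Real.pi → _ :=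
    fun ha hd => h₃.left_right_lt h₁.shift h31 hd ha
  rw [unitVec_add_two_pi] at s31
  have := h₁.le; have := h₁.lt; have := h₂.le; have := h₂.lt; have := h₃.le; have := h₃.lt
  by_cases z₁ : a₁ = 0
  · have z₂ : a₂ ≠ 0 := fun h => ha12 (z₁.trans h.symm)
    have z₃ : a₃ ≠ 0 := fun h => ha31 (h.trans z₁.symm)
    rcases c23.lt_or_eq with hd | hd
    · linarith [s23 z₂ hd]
    · linarith [s31 z₃ (by linarith)]
  rcases c12.lt_or_eq with hd | hd
  · linarith [s12 z₁ hd]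
  by_cases z₂ : a₂ = 0
  · have z₃ : a₃ ≠ 0 := fun h => ha23 (z₂.trans h.symm)
    linarith [s31 z₃ (by linarith)]
  · linarith [s23 z₂ (by linarith)]

end PolarEdge

/-! ### Directions of positively dependent vectors -/

/-- Three vectors with a positive linear relation: two of them are opposite, or they positively
span the plane. -/
lemma exists_directions {c₁ c₂ c₃ : EuclideanSpace ℝ (Fin 2)} {l₁ l₂ l₃ : ℝ} (hl₁ : 0 < l₁)
    (hl₂ : 0 < l₂) (hl₃ : 0 < l₃) (hc₁ : c₁ ≠ 0) (hc₂ : c₂ ≠ 0) (hc₃ : c₃ ≠ 0)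
    (h : l₁ • c₁ + l₂ • c₂ + l₃ • c₃ = 0) :
    ∃ g₁ g₂ g₃, c₁ = ‖c₁‖ • unitVec g₁ ∧ c₂ = ‖c₂‖ • unitVec g₂ ∧ c₃ = ‖c₃‖ • unitVec g₃ ∧
      (g₂ = g₁ + Real.pi ∨ g₃ = g₁ + Real.pi ∨
      (g₂ < g₁ + Real.pi ∧ g₃ < g₂ + Real.pi ∧ g₁ + 2 * Real.pi < g₃ + Real.pi) ∨
      (g₃ < g₁ + Real.pi ∧ g₂ < g₃ + Real.pi ∧ g₁ + 2 * Real.pi < g₂ + Real.pi)) := by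
  obtain ⟨g₁, -, -, e₁⟩ := exists_polar 0 c₁
  rw [zero_add] at e₁
  obtain ⟨k₂, l2, u2, e₂⟩ := exists_polar g₁ c₂
  obtain ⟨k₃, l3, u3, e₃⟩ := exists_polar g₁ c₃
  have n₁ := mul_pos hl₁ (norm_pos_iff.2 hc₁)
  have n₂ := mul_pos hl₂ (norm_pos_iff.2 hc₂)
  have n₃ := mul_pos hl₃ (norm_pos_iff.2 hc₃)
  have key : ∀ t, l₁ * ‖c₁‖ * Real.cos (g₁ - t) + l₂ * ‖c₂‖ * Real.cos (g₁ + k₂ - t) +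
      l₃ * ‖c₃‖ * Real.cos (g₁ + k₃ - t) = 0 := by
    intro t
    have := congrArg (fun v => ⟪v, unitVec t⟫) h
    simp only [inner_add_left, real_inner_smul_left, inner_zero_left] at this
    nth_rewrite 1 [e₁, e₂, e₃] at this
    simp only [real_inner_smul_left, inner_unitVec_unitVec] at this
    linarith
  -- Projections of the relation on `c₁`, on the normal of `c₁` and on the normal of `c₂`; the last
  -- two give the signs of the sines of the angles between the vectors.
  have r0 := key g₁
  have r1 := key (g₁ + Real.pi / 2)
  have r2 := key (g₁ + k₂ + Real.pi / 2)
  simp only [sub_self, Real.cos_zero, add_sub_cancel_left] at r0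
  rw [show g₁ - (g₁ + Real.pi / 2) = -(Real.pi / 2) by ring,
    show g₁ + k₂ - (g₁ + Real.pi / 2) = k₂ - Real.pi / 2 by ring,
    show g₁ + k₃ - (g₁ + Real.pi / 2) = k₃ - Real.pi / 2 by ring, Real.cos_neg,
    Real.cos_pi_div_two, Real.cos_sub_pi_div_two, Real.cos_sub_pi_div_two] at r1
  rw [show g₁ - (g₁ + k₂ + Real.pi / 2) = -k₂ - Real.pi / 2 by ring,
    show g₁ + k₂ - (g₁ + k₂ + Real.pi / 2) = -(Real.pi / 2) by ring,
    show g₁ + k₃ - (g₁ + k₂ + Real.pi / 2) = k₃ - k₂ - Real.pi / 2 by ring, Real.cos_neg,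
    Real.cos_pi_div_two, Real.cos_sub_pi_div_two, Real.cos_sub_pi_div_two, Real.sin_neg] at r2
  have hpi := Real.pi_pos
  by_cases p2 : k₂ = Real.pi
  · exact ⟨g₁, g₁ + k₂, g₁ + k₃, e₁, e₂, e₃, Or.inl (by rw [p2])⟩
  by_cases p3 : k₃ = Real.pi
  · exact ⟨g₁, g₁ + k₂, g₁ + k₃, e₁, e₂, e₃, Or.inr (Or.inl (by rw [p3]))⟩
  have u2' := lt_of_le_of_ne u2 p2
  have u3' := lt_of_le_of_ne u3 p3
  rcases lt_trichotomy k₂ 0 with hk | hk | hk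
  · have s2 := Real.sin_neg_of_neg_of_neg_pi_lt hk l2
    have s3 : 0 < Real.sin k₃ := by
      by_contra hc
      nlinarith
    have k3 : 0 < k₃ := by
      by_contra hc
      linarith [Real.sin_nonpos_of_nonpos_of_neg_pi_le (not_lt.1 hc) l3.le]
    have s23 : Real.sin (k₃ - k₂) < 0 := by
      by_contra hc
      nlinarith
    have : Real.pi < k₃ - k₂ := by
      by_contra hc
      linarith [Real.sin_nonneg_of_nonneg_of_le_pi (by linarith) (not_lt.1 hc)]
    refine ⟨g₁, g₁ + k₂ + 2 * Real.pi, g₁ + k₃, e₁, by rwa [unitVec_add_two_pi], e₃,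
      Or.inr (Or.inr (Or.inr ⟨?_, ?_, ?_⟩))⟩ <;> linarith
  · rw [hk, Real.sin_zero] at r1
    have s3 : Real.sin k₃ = 0 := by
      have : l₃ * ‖c₃‖ * Real.sin k₃ = 0 := by linarith
      exact (mul_eq_zero.1 this).resolve_left n₃.ne'
    have k3 := (Real.sin_eq_zero_iff_of_lt_of_lt l3 u3').1 s3
    rw [hk, k3, Real.cos_zero] at r0
    linarith
  · have s2 := Real.sin_pos_of_pos_of_lt_pi hk u2'
    have s3 : Real.sin k₃ < 0 := by
      by_contra hc
      nlinarith
    have k3 : k₃ < 0 := by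
      by_contra hc
      linarith [Real.sin_nonneg_of_nonneg_of_le_pi (not_lt.1 hc) u3]
    have s23 : 0 < Real.sin (k₃ - k₂) := by
      by_contra hc
      nlinarith
    have : k₃ - k₂ < -Real.pi := by
      by_contra hc
      linarith [Real.sin_nonpos_of_nonpos_of_neg_pi_le (by linarith) (not_lt.1 hc)]
    refine ⟨g₁, g₁ + k₂, g₁ + k₃ + 2 * Real.pi, e₁, e₂, by rwa [unitVec_add_two_pi],
      Or.inr (Or.inr (Or.inl ⟨?_, ?_, ?_⟩))⟩ <;> linarith

/-! ### Stable pairings -/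

/-- A pairing `σ` of distinct points such that no exchange along an alternating cycle with two or
three edges of the pairing increases the sum of the lengths. -/
structure IsExchangeStable {V : Type*} (p : V → EuclideanSpace ℝ (Fin 2)) (σ : V → V) :
    Prop where
  injective : Function.Injective p
  invol : ∀ x, σ (σ x) = x
  ne : ∀ x, σ x ≠ x
  swap : ∀ x y, y ≠ x → y ≠ σ x →
    dist (p x) (p y) + dist (p (σ x)) (p (σ y)) ≤ dist (p x) (p (σ x)) + dist (p y) (p (σ y))
  cycle : ∀ x y z, y ≠ x → y ≠ σ x → z ≠ x → z ≠ σ x → z ≠ y → z ≠ σ y →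
    dist (p x) (p (σ y)) + dist (p y) (p (σ z)) + dist (p z) (p (σ x)) ≤
      dist (p x) (p (σ x)) + dist (p y) (p (σ y)) + dist (p z) (p (σ z))

namespace IsExchangeStable

variable {V : Type*} {p : V → EuclideanSpace ℝ (Fin 2)} {σ : V → V}

lemma translate (h : IsExchangeStable p σ) (o : EuclideanSpace ℝ (Fin 2)) :
    IsExchangeStable (fun x => p x - o) σ where
  injective := fun x y hxy => h.injective (sub_left_injective hxy)
  invol := h.invol
  ne := h.ne
  swap := by simpa only [dist_sub_right] using h.swap
  cycle := by simpa only [dist_sub_right] using h.cycle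

lemma add_ne_zero (h : IsExchangeStable p σ) {x : V} (hx : 0 ≤ ⟪p x, p (σ x)⟫) :
    p x + p (σ x) ≠ 0 := by
  intro h0
  have h1 : p (σ x) = -p x := (neg_eq_of_add_eq_zero_right h0).symm
  rw [h1, inner_neg_right, real_inner_self_eq_norm_sq] at hx
  have h2 : p x = 0 := by
    rw [← norm_eq_zero]; nlinarith [norm_nonneg (p x)]
  exact h.ne x (h.injective (by rw [h1, h2, neg_zero]))

lemma exists_polarEdge (h : IsExchangeStable p σ) {x : V} (hx : 0 ≤ ⟪p x, p (σ x)⟫) {g : ℝ}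
    (hg : p x + p (σ x) = ‖p x + p (σ x)‖ • unitVec g) :
    ∃ x' d, (x' = x ∨ x' = σ x) ∧ PolarEdge (p x') (p (σ x')) g d := by
  rcases _root_.exists_polarEdge (fun hc => h.ne x (h.injective hc).symm) hx hg with
    ⟨d, hd⟩ | ⟨d, hd⟩
  · exact ⟨x, d, Or.inl rfl, hd⟩
  · exact ⟨σ x, d, Or.inr rfl, by rwa [h.invol]⟩

lemma ne_of_mem (h : IsExchangeStable p σ) {x y x' y' : V} (h1 : y ≠ x) (h2 : y ≠ σ x)
    (hx : x' = x ∨ x' = σ x) (hy : y' = y ∨ y' = σ y) : y' ≠ x' ∧ y' ≠ σ x' := by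
  have h3 : σ y ≠ x := fun hc => h2 (by rw [← hc, h.invol])
  have h4 : σ y ≠ σ x := fun hc => h1 (by rw [← h.invol y, hc, h.invol])
  rcases hx with rfl | rfl <;> rcases hy with rfl | rfl <;> simp [h.invol, *]

lemma false_of_opposite (h : IsExchangeStable p σ) {x y : V} (h1 : y ≠ x) (h2 : y ≠ σ x)
    (hx : 0 ≤ ⟪p x, p (σ x)⟫) (hy : 0 ≤ ⟪p y, p (σ y)⟫) {g : ℝ}
    (hgx : p x + p (σ x) = ‖p x + p (σ x)‖ • unitVec g)
    (hgy : p y + p (σ y) = ‖p y + p (σ y)‖ • unitVec (g + Real.pi)) : False := by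
  obtain ⟨x', d, hx', e⟩ := h.exists_polarEdge hx hgx
  obtain ⟨y', d', hy', e'⟩ := h.exists_polarEdge hy hgy
  obtain ⟨n1, n2⟩ := h.ne_of_mem h1 h2 hx' hy'
  have := e.le; have := e.lt; have := e'.le; have := e'.lt
  have := e.swap_lt e' (by linarith) (by linarith) (by linarith) (by linarith)
    (fun hc => n1 (h.injective hc).symm)
  linarith [h.swap x' y' n1 n2]

lemma false_of_spanning (h : IsExchangeStable p σ) {x y z : V} (hyx : y ≠ x) (hyx' : y ≠ σ x)
    (hzx : z ≠ x) (hzx' : z ≠ σ x) (hzy : z ≠ y) (hzy' : z ≠ σ y) (hx : 0 ≤ ⟪p x, p (σ x)⟫)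
    (hy : 0 ≤ ⟪p y, p (σ y)⟫) (hz : 0 ≤ ⟪p z, p (σ z)⟫) {g₁ g₂ g₃ : ℝ}
    (hgx : p x + p (σ x) = ‖p x + p (σ x)‖ • unitVec g₁)
    (hgy : p y + p (σ y) = ‖p y + p (σ y)‖ • unitVec g₂)
    (hgz : p z + p (σ z) = ‖p z + p (σ z)‖ • unitVec g₃)
    (hg : g₂ < g₁ + Real.pi ∧ g₃ < g₂ + Real.pi ∧ g₁ + 2 * Real.pi < g₃ + Real.pi) : False := by
  obtain ⟨x', d₁, hx', e₁⟩ := h.exists_polarEdge hx hgx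
  obtain ⟨y', d₂, hy', e₂⟩ := h.exists_polarEdge hy hgy
  obtain ⟨z', d₃, hz', e₃⟩ := h.exists_polarEdge hz hgz
  obtain ⟨n1, n1'⟩ := h.ne_of_mem hyx hyx' hx' hy'
  obtain ⟨n2, n2'⟩ := h.ne_of_mem hzx hzx' hx' hz'
  obtain ⟨n3, n3'⟩ := h.ne_of_mem hzy hzy' hy' hz'
  obtain ⟨q1, q2, q3⟩ := hg
  have s1 := h.swap x' y' n1 n1'
  have s2 := h.swap x' z' n2 n2'
  have s3 := h.swap y' z' n3 n3'
  have s4 := h.cycle x' y' z' n1 n1' n2 n2' n3 n3'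
  rcases e₁.exists_exchange e₂ e₃ q1 q2 q3 (fun hc => n1 (h.injective hc).symm)
    (fun hc => n3 (h.injective hc).symm) (fun hc => n2 (h.injective hc)) with hc | hc | hc | hc
  · linarith
  · linarith
  · rw [dist_comm (p z') (p x'), dist_comm (p (σ z')) (p (σ x'))] at hc
    linarith
  · linarith

/-- The origin is not a positive combination of the sums of the end points of at most three
edges that it sees under non-obtuse angles. -/
theorem sum_smul_ne_zero (h : IsExchangeStable p σ) {n : ℕ} (hn : n ≤ 3) (hn0 : 0 < n)
    (x : Fin n → V)
    (hx : ∀ i j, i ≠ j → x i ≠ x j ∧ x i ≠ σ (x j)) (hi : ∀ i, 0 ≤ ⟪p (x i), p (σ (x i))⟫)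
    (l : Fin n → ℝ) (hl : ∀ i, 0 < l i) :
    ∑ i, l i • (p (x i) + p (σ (x i))) ≠ 0 := by
  intro hs
  interval_cases n
  · rw [Fin.sum_univ_one] at hs
    exact h.add_ne_zero (hi 0) ((smul_eq_zero.1 hs).resolve_left (hl 0).ne')
  · rw [Fin.sum_univ_two] at hs
    -- Splitting the second term in two equal halves reduces two vectors to the case of three; a
    -- spanning configuration is then impossible, as two of the directions coincide.
    have hs' : (l 0) • (p (x 0) + p (σ (x 0))) + (l 1 / 2) • (p (x 1) + p (σ (x 1))) +
        (l 1 / 2) • (p (x 1) + p (σ (x 1))) = 0 := by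
      rw [add_assoc, ← add_smul, add_halves, hs]
    have p1 := half_pos (hl 1)
    have n0 := h.add_ne_zero (hi 0)
    have n1 := h.add_ne_zero (hi 1)
    have hne := hx 1 0 (by decide)
    obtain ⟨g₁, g₂, g₃, e₁, e₂, e₃, hg⟩ := exists_directions (hl 0) p1 p1 n0 n1 n1 hs'
    rcases hg with hg | hg | hg | hg
    · exact h.false_of_opposite hne.1 hne.2 (hi 0) (hi 1) e₁ (hg ▸ e₂)
    · exact h.false_of_opposite hne.1 hne.2 (hi 0) (hi 1) e₁ (hg ▸ e₃)
    all_goals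
      have hn : ‖p (x 1) + p (σ (x 1))‖ ≠ 0 := norm_ne_zero_iff.2 n1
      have he : unitVec g₂ = unitVec g₃ := by
        have := e₂.symm.trans e₃
        exact smul_right_injective _ hn this
      have h1 := inner_unitVec_unitVec g₂ g₃
      rw [← he, inner_unitVec_unitVec, sub_self, Real.cos_zero] at h1
      have h2 := (Real.cos_eq_one_iff_of_lt_of_lt (by linarith [Real.pi_pos])
        (by linarith [Real.pi_pos])).1 h1.symm
      linarith
  · rw [Fin.sum_univ_three] at hs
    have h10 := hx 1 0 (by decide)
    have h20 := hx 2 0 (by decide)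
    have h21 := hx 2 1 (by decide)
    have h12 := hx 1 2 (by decide)
    obtain ⟨g₁, g₂, g₃, e₁, e₂, e₃, hg⟩ := exists_directions (hl 0) (hl 1) (hl 2)
      (h.add_ne_zero (hi 0)) (h.add_ne_zero (hi 1)) (h.add_ne_zero (hi 2)) hs
    rcases hg with hg | hg | hg | hg
    · exact h.false_of_opposite h10.1 h10.2 (hi 0) (hi 1) e₁ (hg ▸ e₂)
    · exact h.false_of_opposite h20.1 h20.2 (hi 0) (hi 2) e₁ (hg ▸ e₃)
    · exact h.false_of_spanning h10.1 h10.2 h20.1 h20.2 h21.1 h21.2 (hi 0) (hi 1) (hi 2)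
        e₁ e₂ e₃ hg
    · exact h.false_of_spanning h20.1 h20.2 h10.1 h10.2 h12.1 h12.2 (hi 0) (hi 2) (hi 1)
        e₁ e₃ e₂ hg

end IsExchangeStable

/-! ### The minimax point and the discs -/

open Filter Topology in
/-- Either finitely many open balls have a common point, or there is a point outside of some of
them that is a convex combination of their centres; in the plane three balls suffice. -/
theorem exists_common_point_or_combination {ι : Type*} [Fintype ι] [Nonempty ι]
    (m : ι → EuclideanSpace ℝ (Fin 2)) (r : ι → ℝ) :
    (∃ o, ∀ i, ‖o - m i‖ ^ 2 < r i) ∨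
    ∃ (o : EuclideanSpace ℝ (Fin 2)) (n : ℕ) (x : Fin n → ι) (l : Fin n → ℝ), n ≤ 3 ∧ 0 < n ∧
      Function.Injective (m ∘ x) ∧ (∀ i, r (x i) ≤ ‖o - m (x i)‖ ^ 2) ∧ (∀ i, 0 < l i) ∧
      ∑ i, l i • (m (x i) - o) = 0 := by
  set f : ι → EuclideanSpace ℝ (Fin 2) → ℝ := fun i x => ‖x - m i‖ ^ 2 - r i with hf
  set F : EuclideanSpace ℝ (Fin 2) → ℝ :=
    fun x => Finset.univ.sup' Finset.univ_nonempty fun i => f i x with hF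
  have hfc : ∀ i, Continuous (f i) := fun i => by simp only [hf]; fun_prop
  have hFc : Continuous F := Continuous.finset_sup'_apply _ fun i _ => hfc i
  have hle : ∀ i x, f i x ≤ F x := fun i x => Finset.le_sup' (fun i => f i x) (Finset.mem_univ i)
  obtain ⟨o, ho⟩ : ∃ o, ∀ x, F o ≤ F x := by
    apply hFc.exists_forall_le
    obtain ⟨i⟩ := ‹Nonempty ι›
    refine tendsto_atTop_mono (hle i) ?_
    simp only [hf, sub_eq_add_neg _ (r i), ← dist_eq_norm]
    exact tendsto_atTop_add_const_right _ _
      ((tendsto_pow_atTop two_ne_zero).comp (tendsto_dist_right_cocompact_atTop (m i)))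
  by_cases hneg : F o < 0
  · exact Or.inl ⟨o, fun i => sub_neg.1 ((hle i o).trans_lt hneg)⟩
  right
  -- Otherwise a hyperplane separates `o` from the active centres. A small step from `o` along its
  -- normal `v` decreases every active `f i`, while the inactive ones stay below `F o` by
  -- continuity, against minimality.
  have hmem : o ∈ convexHull ℝ (m '' {i | f i o = F o}) := by
    by_contra hn
    obtain ⟨φ, u, hu, hu'⟩ := geometric_hahn_banach_point_closed (convex_convexHull ℝ _)
      ((Set.toFinite (m '' {i | f i o = F o})).isClosed_convexHull ℝ) hn
    set v := (InnerProductSpace.toDual ℝ _).symm φ with hv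
    have hφ : ∀ x, φ x = ⟪v, x⟫ := fun x => by
      rw [hv, InnerProductSpace.toDual_symm_apply]
    have hev : ∀ i, ∀ᶠ ε : ℝ in 𝓝[>] 0, f i (o + ε • v) < F o := by
      intro i
      by_cases hi : f i o = F o
      · have hpos : 0 < ⟪v, m i - o⟫ := by
          rw [inner_sub_right, ← hφ, ← hφ]
          linarith [hu' _ (subset_convexHull ℝ _ ⟨i, hi, rfl⟩)]
        have hlim : Tendsto (fun ε : ℝ => ε * ‖v‖ ^ 2) (𝓝[>] 0) (𝓝 0) := by
          have : Continuous fun ε : ℝ => ε * ‖v‖ ^ 2 := by fun_prop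
          simpa using (this.tendsto 0).mono_left nhdsWithin_le_nhds
        filter_upwards [hlim.eventually_lt_const (by linarith : (0 : ℝ) < 2 * ⟪v, m i - o⟫),
          self_mem_nhdsWithin] with ε h1 h2
        have h2 : 0 < ε := h2
        have e : f i (o + ε • v) = f i o + ε * (ε * ‖v‖ ^ 2 - 2 * ⟪v, m i - o⟫) := by
          simp only [hf]
          rw [show o + ε • v - m i = ε • v - (m i - o) by abel, norm_sub_sq_real,
            norm_sub_rev o (m i), norm_smul, real_inner_smul_left, mul_pow, Real.norm_eq_abs,
            sq_abs]
          ring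
        rw [e, hi]
        nlinarith
      · have hc : Continuous fun ε : ℝ => f i (o + ε • v) := (hfc i).comp (by fun_prop)
        have := (hc.tendsto 0).mono_left (nhdsWithin_le_nhds (s := Set.Ioi 0))
        rw [zero_smul, add_zero] at this
        exact this.eventually_lt_const (lt_of_le_of_ne (hle i o) hi)
    obtain ⟨ε, hε⟩ := (eventually_all.2 hev).exists
    exact (ho (o + ε • v)).not_gt ((Finset.sup'_lt_iff _).2 fun i _ => hε i)
  -- Carathéodory: affinely independent centres with positive weights, hence at most three in the
  -- plane.
  obtain ⟨κ, _, z, w, hz, haff, hw, hw1, hwz⟩ := eq_pos_convex_span_of_mem_convexHull hmem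
  have hex : ∀ k, ∃ i, f i o = F o ∧ m i = z k := fun k => hz ⟨k, rfl⟩
  choose y hy hyz using hex
  have hcard : Fintype.card κ ≤ 3 := by
    refine haff.card_le_finrank_succ.trans (Nat.succ_le_succ ?_)
    exact (Submodule.finrank_le _).trans (by simp)
  have hpos : 0 < Fintype.card κ := by
    rw [Fintype.card_pos_iff]
    by_contra hne
    rw [not_nonempty_iff] at hne
    simp at hw1
  let e := (Fintype.equivFin κ).symm
  refine ⟨o, Fintype.card κ, y ∘ e, w ∘ e, hcard, hpos, ?_, fun i => ?_, fun i => hw _, ?_⟩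
  · intro i j hij
    simp only [Function.comp_apply, hyz] at hij
    exact e.injective (haff.injective hij)
  · have := hy (e i)
    simp only [hf] at this
    simp only [Function.comp_apply]
    linarith
  · simp only [Function.comp_apply]
    rw [e.sum_comp (fun k => w k • (m (y k) - o))]
    simp only [hyz, smul_sub, Finset.sum_sub_distrib, ← Finset.sum_smul, hw1, hwz, one_smul,
      sub_self]

/-- The open diametral balls of a stable pairing have a common point. -/
theorem IsExchangeStable.exists_mem_openDiametralBall {V : Type*} [Fintype V]
    {p : V → EuclideanSpace ℝ (Fin 2)} {σ : V → V} (h : IsExchangeStable p σ) :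
    ∃ o, ∀ x, o ∈ openDiametralBall (p x) (p (σ x)) := by
  cases isEmpty_or_nonempty V
  · exact ⟨0, fun x => isEmptyElim x⟩
  have hmid : ∀ x, midpoint ℝ (p x) (p (σ x)) = (2⁻¹ : ℝ) • (p x + p (σ x)) := fun x => by
    rw [midpoint_eq_smul_add]; simp
  have hid : ∀ o x, ⟪p x - o, p (σ x) - o⟫ =
      ‖o - midpoint ℝ (p x) (p (σ x))‖ ^ 2 - (dist (p x) (p (σ x)) / 2) ^ 2 := by
    intro o x
    have e1 : o - midpoint ℝ (p x) (p (σ x)) =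
        -((2⁻¹ : ℝ) • ((p x - o) + (p (σ x) - o))) := by
      rw [hmid]; module
    have e2 : dist (p x) (p (σ x)) = ‖(p x - o) - (p (σ x) - o)‖ := by
      rw [dist_eq_norm]; congr 1; abel
    rw [e1, e2]
    generalize p x - o = u, p (σ x) - o = v
    rw [norm_neg, norm_smul, mul_pow, div_pow, norm_add_sq_real, norm_sub_sq_real]
    norm_num
    ring
  rcases exists_common_point_or_combination (fun x => midpoint ℝ (p x) (p (σ x)))
    (fun x => (dist (p x) (p (σ x)) / 2) ^ 2) with ⟨o, ho⟩ | ⟨o, n, x, l, hn, hn0, hinj, hr, hl, hs⟩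
  · refine ⟨o, fun x => ?_⟩
    rw [openDiametralBall, Metric.mem_ball, dist_eq_norm]
    exact lt_of_pow_lt_pow_left₀ 2 (by positivity) (ho x)
  · exfalso
    -- The chosen midpoints are distinct, so the chosen edges are distinct too, in either
    -- orientation.
    refine (h.translate o).sum_smul_ne_zero hn hn0 x (fun i j hij => ⟨fun hc => ?_, fun hc => ?_⟩)
      (fun i => ?_) l hl ?_
    · exact hij (hinj (by simp only [Function.comp_apply, hc]))
    · refine hij (hinj ?_)
      simp only [Function.comp_apply, hc, h.invol]
      exact midpoint_comm _ _
    · rw [hid]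
      exact sub_nonneg.2 (hr i)
    · have : ∀ i, l i • ((p (x i) - o) + (p (σ (x i)) - o)) =
          (2 : ℝ) • (l i • (midpoint ℝ (p (x i)) (p (σ (x i))) - o)) := fun i => by
        rw [hmid]; module
      simp only [this, ← Finset.smul_sum, hs, smul_zero]

/-! ### From max-sum matchings to stable pairings -/

lemma IsPerfectMatchingGraph.exists_partner {V : Type*} {M : SimpleGraph V}
    (h : IsPerfectMatchingGraph M) : ∃ σ : V → V, ∀ x y, M.Adj x y ↔ y = σ x := by
  rw [IsPerfectMatchingGraph, SimpleGraph.Subgraph.isPerfectMatching_iff] at h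
  simp only [SimpleGraph.Subgraph.top_adj] at h
  choose σ h1 h2 using h
  exact ⟨σ, fun x y => ⟨h2 x y, fun hy => hy ▸ h1 x⟩⟩

lemma isPerfectMatchingGraph_of_adj_iff {V : Type*} {M : SimpleGraph V} {σ : V → V}
    (h : ∀ x y, M.Adj x y ↔ y = σ x) : IsPerfectMatchingGraph M := by
  rw [IsPerfectMatchingGraph, SimpleGraph.Subgraph.isPerfectMatching_iff]
  intro v
  simp only [SimpleGraph.Subgraph.top_adj, h]
  exact ⟨σ v, rfl, fun _ hy => hy⟩

section

variable {d : ℕ} {S : Finset (EuclideanSpace ℝ (Fin d))} {M : SimpleGraph ↥S} {σ : ↥S → ↥S}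

/-- Summing over the vertices of a perfect matching counts each edge twice. -/
lemma two_mul_graphCost (h : ∀ x y, M.Adj x y ↔ y = σ x) :
    2 * graphCost M = ∑ x : ↥S, dist (x : EuclideanSpace ℝ (Fin d)) (σ x) := by
  classical
  have hadj : ∀ x, M.Adj x (σ x) := fun x => (h x _).2 rfl
  have hinv : ∀ x, σ (σ x) = x := fun x => ((h _ _).1 (hadj x).symm).symm
  rw [graphCost, Finset.mul_sum, ← Finset.sum_fiberwise_of_maps_to
    (s := Finset.univ) (g := fun x => s(x, σ x)) (t := M.edgeFinset)
    (fun x _ => by rw [SimpleGraph.mem_edgeFinset]; exact hadj x)]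
  refine Finset.sum_congr (by congr!) fun e he => ?_
  induction e with
  | _ x y =>
    have hxy : y = σ x := (h x y).1 (by simpa using he)
    subst hxy
    have hfib : Finset.univ.filter (fun z => s(z, σ z) = s(x, σ x)) = {x, σ x} := by
      ext z
      simp only [Finset.mem_filter, Finset.mem_univ, true_and, Finset.mem_insert,
        Finset.mem_singleton, Sym2.eq_iff]
      constructor
      · rintro (⟨h1, -⟩ | ⟨h1, -⟩)
        exacts [Or.inl h1, Or.inr h1]
      · rintro (rfl | rfl)
        exacts [Or.inl ⟨rfl, rfl⟩, Or.inr ⟨rfl, hinv _⟩]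
    rw [hfib, Finset.sum_pair (hadj x).ne, hinv, dist_comm (σ x : EuclideanSpace ℝ (Fin d)),
      two_mul]
    rfl

/-- Relabelling the vertices of a max-sum matching does not increase its cost. -/
lemma IsMaxSumMatching.sum_dist_perm_le (hM : IsMaxSumMatching M)
    (h : ∀ x y, M.Adj x y ↔ y = σ x) (τ : Equiv.Perm ↥S) :
    ∑ x : ↥S, dist (τ x : EuclideanSpace ℝ (Fin d)) (τ (σ x)) ≤
      ∑ x : ↥S, dist (x : EuclideanSpace ℝ (Fin d)) (σ x) := by
  have h' : ∀ x y, (M.comap τ.symm).Adj x y ↔ y = τ (σ (τ.symm x)) := fun x y => by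
    rw [SimpleGraph.comap_adj, h, Equiv.symm_apply_eq]
  have hle := hM.2 _ (isPerfectMatchingGraph_of_adj_iff h')
  have e := two_mul_graphCost h'
  rw [← Equiv.sum_comp τ] at e
  simp only [Equiv.symm_apply_apply] at e
  linarith [two_mul_graphCost h]

end

/-- Each exchange is a relabelling of the vertices: a transposition for two edges, a three-cycle of
the partners for three. Edges outside the exchange keep their length, and in the vertex sums each
remaining edge counts twice. -/
lemma IsMaxSumMatching.isExchangeStable {S : Finset (EuclideanSpace ℝ (Fin 2))}
    {M : SimpleGraph ↥S} {σ : ↥S → ↥S} (hM : IsMaxSumMatching M)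
    (h : ∀ x y, M.Adj x y ↔ y = σ x) :
    IsExchangeStable (fun x : ↥S => (x : EuclideanSpace ℝ (Fin 2))) σ := by
  classical
  have hadj : ∀ x, M.Adj x (σ x) := fun x => (h x _).2 rfl
  have hinv : ∀ x, σ (σ x) = x := fun x => ((h _ _).1 (hadj x).symm).symm
  have hne : ∀ x, σ x ≠ x := fun x => (hadj x).ne'
  have hinj : Function.Injective σ := fun x y hxy => by rw [← hinv x, hxy, hinv]
  have hτ := fun τ => sub_nonneg.2 (hM.sum_dist_perm_le h τ)
  simp only [← Finset.sum_sub_distrib] at hτ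
  refine ⟨Subtype.val_injective, hinv, hne, fun x y h1 h2 => ?_,
    fun x y z h1 h2 h3 h4 h5 h6 => ?_⟩
  · have h3 : σ y ≠ x := fun hc => h2 (by rw [← hc, hinv])
    have h4 : σ y ≠ σ x := fun hc => h1 (hinj hc)
    have key := hτ (Equiv.swap (σ x) y)
    rw [← Finset.sum_subset (Finset.subset_univ {x, σ x, y, σ y})] at key
    · rw [Finset.sum_insert (by simp [h1.symm, h3.symm, (hne x).symm]),
        Finset.sum_insert (by simp [h2.symm, h4.symm]), Finset.sum_pair (hne y).symm] at key
      simp only [hinv, Equiv.swap_apply_left, Equiv.swap_apply_right,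
        Equiv.swap_apply_of_ne_of_ne (hne x).symm h1.symm,
        Equiv.swap_apply_of_ne_of_ne h4 (hne y)] at key
      simp only [dist_comm (y : EuclideanSpace ℝ (Fin 2)) x,
        dist_comm (σ x : EuclideanSpace ℝ (Fin 2)) x,
        dist_comm (σ y : EuclideanSpace ℝ (Fin 2)) y,
        dist_comm (σ y : EuclideanSpace ℝ (Fin 2)) (σ x)] at key
      linarith
    · intro u _ hu
      simp only [Finset.mem_insert, Finset.mem_singleton, not_or] at hu
      obtain ⟨u1, u2, u3, u4⟩ := hu
      rw [Equiv.swap_apply_of_ne_of_ne u2 u3, Equiv.swap_apply_of_ne_of_ne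
        (fun hc => u1 (hinj hc)) (fun hc => u4 (by rw [← hc, hinv])), sub_self]
  · have q1 : σ y ≠ x := fun hc => h2 (by rw [← hc, hinv])
    have q2 : σ y ≠ σ x := fun hc => h1 (hinj hc)
    have q3 : σ z ≠ x := fun hc => h4 (by rw [← hc, hinv])
    have q4 : σ z ≠ σ x := fun hc => h3 (hinj hc)
    have q5 : σ z ≠ y := fun hc => h6 (by rw [← hc, hinv])
    have q6 : σ z ≠ σ y := fun hc => h5 (hinj hc)
    have key := hτ (Equiv.swap (σ x) (σ y) * Equiv.swap (σ y) (σ z))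
    rw [← Finset.sum_subset (Finset.subset_univ {x, σ x, y, σ y, z, σ z})] at key
    · rw [Finset.sum_insert (by simp [h1.symm, h3.symm, q1.symm, q3.symm, (hne x).symm]),
        Finset.sum_insert (by simp [h2.symm, h4.symm, q2.symm, q4.symm]),
        Finset.sum_insert (by simp [h5.symm, q5.symm, (hne y).symm]),
        Finset.sum_insert (by simp [h6.symm, q6.symm]),
        Finset.sum_pair (hne z).symm] at key
      have tx : (Equiv.swap (σ x) (σ y) * Equiv.swap (σ y) (σ z)) x = x := by
        rw [Equiv.Perm.mul_apply, Equiv.swap_apply_of_ne_of_ne q1.symm q3.symm,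
          Equiv.swap_apply_of_ne_of_ne (hne x).symm q1.symm]
      have ty : (Equiv.swap (σ x) (σ y) * Equiv.swap (σ y) (σ z)) y = y := by
        rw [Equiv.Perm.mul_apply, Equiv.swap_apply_of_ne_of_ne (hne y).symm q5.symm,
          Equiv.swap_apply_of_ne_of_ne h2 (hne y).symm]
      have tz : (Equiv.swap (σ x) (σ y) * Equiv.swap (σ y) (σ z)) z = z := by
        rw [Equiv.Perm.mul_apply, Equiv.swap_apply_of_ne_of_ne h6 (hne z).symm,
          Equiv.swap_apply_of_ne_of_ne h4 h6]
      have tx' : (Equiv.swap (σ x) (σ y) * Equiv.swap (σ y) (σ z)) (σ x) = σ y := by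
        rw [Equiv.Perm.mul_apply, Equiv.swap_apply_of_ne_of_ne q2.symm q4.symm,
          Equiv.swap_apply_left]
      have ty' : (Equiv.swap (σ x) (σ y) * Equiv.swap (σ y) (σ z)) (σ y) = σ z := by
        rw [Equiv.Perm.mul_apply, Equiv.swap_apply_left,
          Equiv.swap_apply_of_ne_of_ne q4 q6]
      have tz' : (Equiv.swap (σ x) (σ y) * Equiv.swap (σ y) (σ z)) (σ z) = σ x := by
        rw [Equiv.Perm.mul_apply, Equiv.swap_apply_right, Equiv.swap_apply_right]
      simp only [hinv, tx, ty, tz, tx', ty', tz'] at key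
      simp only [dist_comm (σ y : EuclideanSpace ℝ (Fin 2)) x,
        dist_comm (σ x : EuclideanSpace ℝ (Fin 2)) x,
        dist_comm (σ y : EuclideanSpace ℝ (Fin 2)) y,
        dist_comm (σ z : EuclideanSpace ℝ (Fin 2)) y,
        dist_comm (σ z : EuclideanSpace ℝ (Fin 2)) z,
        dist_comm (σ x : EuclideanSpace ℝ (Fin 2)) z] at key
      linarith
    · intro u _ hu
      simp only [Finset.mem_insert, Finset.mem_singleton, not_or] at hu
      obtain ⟨u1, u2, u3, u4, u5, u6⟩ := hu
      have v1 : σ u ≠ σ x := fun hc => u1 (hinj hc)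
      have v2 : σ u ≠ σ y := fun hc => u3 (hinj hc)
      have v3 : σ u ≠ σ z := fun hc => u5 (hinj hc)
      rw [Equiv.Perm.mul_apply, Equiv.Perm.mul_apply, Equiv.swap_apply_of_ne_of_ne u4 u6,
        Equiv.swap_apply_of_ne_of_ne u2 u4, Equiv.swap_apply_of_ne_of_ne v2 v3,
        Equiv.swap_apply_of_ne_of_ne v1 v2, sub_self]

theorem theorem2 (S : Finset (EuclideanSpace ℝ (Fin 2))) (hS : Even S.card)
    (M : SimpleGraph ↥S) (hM : IsMaxSumMatching M) : IsOpenTverbergGraph M := by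
  obtain ⟨σ, h⟩ := hM.1.exists_partner
  obtain ⟨o, ho⟩ := (hM.isExchangeStable h).exists_mem_openDiametralBall
  refine ⟨o, ?_⟩
  simp only [Set.mem_iInter]
  intro x y hxy
  obtain rfl := (h x y).1 hxy
  exact ho x
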